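/- Let $\pi_1(P)=\langle A,B,C \mid CBA=1\rangle$ be the fundamental group of a pair of pants $P$, with one generator for each boundary component. For a topological group $H$, let $\mathrm{rep}(\pi_1(P),H)$ denote the topological quotient of $\mathrm{Hom}(\pi_1(P),H)$ (with the topology of pointwise convergence) by conjugation by elements of $H$. Let $$G=\{(\theta_0,\theta_1,\theta_2)\in\mathbb R^3 : \theta_0+\theta_1+\theta_2\ge\pi,\ \ \theta_i\ge\theta_{i+1}+\theta_{i+2}-\pi \ \text{for } i\in\mathbb Z/3\}$$ be the solid regular tetrahedron with vertices $(\pi,0,0),(0,\pi,0),(0,0,\pi),(\pi,\pi,\pi)$, and let $V=\{I,I_A,I_B,I_C\}$ act on $G$ by isometries, where $$I_A(\theta_0,\theta_1,\theta_2)=(\theta_0,\pi-\theta_1,\pi-\theta_2),\quad I_B(\theta_0,\theta_1,\theta_2)=(\pi-\theta_0,\theta_1,\pi-\theta_2),\quad I_C(\theta_0,\theta_1,\theta_2)=(\pi-\theta_0,\pi-\theta_1,\theta_2).$$ Let $p:\mathrm{rep}(\pi_1(P),\mathrm{SU}(2))\to\mathrm{rep}(\pi_1(P),\mathrm{SO}(3))$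 be the map induced by the double covering $\mathrm{SU}(2)\to\mathrm{SO}(3)$ (the action of $\mathrm{SU}(2)$ by conjugation on pure quaternions). For a unit vector $w\in\mathbb R^3$ and $\theta\in\mathbb R$, let $R_{w,\theta}=\cos(\theta/2)\,I+\sin(\theta/2)\,w\in\mathrm{SU}(2)$ ($w$ regarded as a pure unit quaternion), which lies over the counter-clockwise rotation about $w$ by the angle $\theta$. Proposition. $V$ is a Klein four-group, and there is a homeomorphism $e:\mathrm{rep}(\pi_1(P),\mathrm{SU}(2))\to G$ with the following properties. (1) If $e([h])=(\theta_0,\theta_1,\theta_2)$, then $h(A)=R_{w_0,2\theta_0}$, $h(B)=R_{w_1,2\theta_1}$ and $h(C)=-R_{w_2,2\theta_2}$ for some unit vectors $w_0,w_1,w_2\in\mathbb R^3$. (2) The map $p\circ e^{-1}:G\to\mathrm{rep}(\pi_1(P),\mathrm{SO}(3))$ induces a homeomorphism $G/V\cong\mathrm{rep}(\pi_1(P),\mathrm{SO}(3))$. (3) $p$ is a four-to-one branched covering whose branch locus $\mathcal B$ is the preimage under $e$ of the union of the three axes, that is, of the segments of $G$ fixed by $I_A$, by $I_B$ and by $I_C$.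 This means: $p$ is a continuous, open and closed surjection with finite fibres; $\mathcal B$ is closed with dense complement and is a union of fibres of $p$; over the complement of $p(\mathcal B)$, $p$ is a covering map all of whose fibres have exactly four points; and $p$ is not injective on any neighbourhood of any point of $\mathcal B$. -/

import Mathlib

open scoped Topology

/-! ### Character spaces -/

/-- The topology of pointwise convergence on the set `Γ →* H` of homomorphisms from a (discrete)
group `Γ` to a topological group `H`.  When `Γ` is generated by a finite family, this is the
topology of `Γ →* H` as a subspace of a finite power of `H`. -/
instance homTopology (Γ H : Type*) [Group Γ] [Group H] [TopologicalSpace H] :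
    TopologicalSpace (Γ →* H) :=
  TopologicalSpace.induced (fun f : Γ →* H => (f : Γ → H)) inferInstance

/-- Two representations are equivalent when they differ by conjugation by an element of `H`. -/
def conjSetoid (Γ H : Type*) [Group Γ] [Group H] : Setoid (Γ →* H) where
  r f f' := ∃ g : H, ∀ γ : Γ, f' γ = g * f γ * g⁻¹
  iseqv :=
    { refl := fun _ => ⟨1, fun _ => by simp⟩
      symm := fun {_ _} ⟨g, hg⟩ => ⟨g⁻¹, fun γ => by rw [hg γ]; group⟩
      trans := fun {_ _ _} ⟨g, hg⟩ ⟨k, hk⟩ => ⟨k * g, fun γ => by rw [hk γ, hg γ]; group⟩ }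

/-- The space of `H`-characters of `Γ`: the topological quotient of the space of representations
`Γ →* H` by conjugation. -/
def CharSpace (Γ H : Type*) [Group Γ] [Group H] : Type _ :=
  Quotient (conjSetoid Γ H)

instance charSpaceTopology (Γ H : Type*) [Group Γ] [Group H] [TopologicalSpace H] :
    TopologicalSpace (CharSpace Γ H) :=
  inferInstanceAs (TopologicalSpace (Quotient (conjSetoid Γ H)))

/-- The character of a representation. -/
def CharSpace.mk {Γ H : Type*} [Group Γ] [Group H] (f : Γ →* H) : CharSpace Γ H :=
  Quotient.mk (conjSetoid Γ H) f

/-- The map of character spaces induced by a homomorphism of the target groups. -/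
def CharSpace.map (Γ : Type*) {H K : Type*} [Group Γ] [Group H] [Group K] (φ : H →* K) :
    CharSpace Γ H → CharSpace Γ K :=
  Quotient.map' (s₁ := conjSetoid Γ H) (s₂ := conjSetoid Γ K) (fun f => φ.comp f)
    (fun _ _ ⟨g, hg⟩ => ⟨φ g, fun γ => by simp [hg γ]⟩)

/-! ### The fundamental group of a pair of pants -/

/-- The fundamental group of a pair of pants, `⟨A, B, C | C B A = 1⟩`, with one generator for each
boundary component: `A`, `B`, `C` are the generators of index `0`, `1`, `2`. -/
abbrev PantsGroup : Type :=
  PresentedGroup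
    ({FreeGroup.of 2 * FreeGroup.of 1 * FreeGroup.of 0} : Set (FreeGroup (Fin 3)))

/-- The generators `A`, `B`, `C` of the pair-of-pants group. -/
def pantsGen (i : Fin 3) : PantsGroup := PresentedGroup.of i

/-! ### `SU(2)`, `SO(3)` and the double covering -/

abbrev SU2 : Type := Matrix.specialUnitaryGroup (Fin 2) ℂ

abbrev SO3 : Type := Matrix.specialOrthogonalGroup (Fin 3) ℝ

/-- The standard basis (the quaternion units) of the space of purely quaternionic matrices, that
is, of the traceless skew-Hermitian complex `2 × 2` matrices. -/
def quatUnit (i : Fin 3) : Matrix (Fin 2) (Fin 2) ℂ :=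
  ![!![Complex.I, 0; 0, -Complex.I], !![0, 1; -1, 0], !![0, Complex.I; Complex.I, 0]] i

/-- The purely quaternionic matrix with coordinate vector `v`. -/
noncomputable def pureQuat (v : Fin 3 → ℝ) : Matrix (Fin 2) (Fin 2) ℂ :=
  ∑ i, (v i : ℂ) • quatUnit i

/-- The matrix, in the basis `quatUnit`, of the map `X ↦ g X g*` on purely quaternionic matrices
(the `i`-th coordinate of such an `X` is `-tr (quatUnit i * X) / 2`). -/
noncomputable def adMatrix (g : Matrix (Fin 2) (Fin 2) ℂ) : Matrix (Fin 3) (Fin 3) ℝ :=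
  Matrix.of fun i j => -(1 / 2) * (quatUnit i * (g * quatUnit j * g.conjTranspose)).trace.re

theorem su2_entries (g : SU2) : ∃ a b c d : ℝ, a ^ 2 + b ^ 2 + c ^ 2 + d ^ 2 = 1 ∧
    g.1 = !![⟨a, b⟩, ⟨c, d⟩; ⟨-c, d⟩, ⟨a, -b⟩] := by
  obtain ⟨hu, hd⟩ := Matrix.mem_specialUnitaryGroup_iff.1 g.2
  have h1 : g.1 * g.1.conjTranspose = 1 := Matrix.mem_unitaryGroup_iff.1 hu
  have h2 : g.1.adjugate = g.1.conjTranspose := by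
    have h3 : g.1.adjugate * (g.1 * g.1.conjTranspose) = g.1.conjTranspose := by
      rw [← mul_assoc, Matrix.adjugate_mul, hd, one_smul, one_mul]
    rwa [h1, mul_one] at h3
  rw [Matrix.adjugate_fin_two] at h2
  have e1 : g.1 1 1 = star (g.1 0 0) := by simpa using congrFun (congrFun h2 0) 0
  have e2 : -g.1 1 0 = star (g.1 0 1) := by simpa using congrFun (congrFun h2 1) 0
  have e3 : g.1 1 0 = -star (g.1 0 1) := by rw [← e2]; ring
  have hd : g.1 0 0 * g.1 1 1 - g.1 0 1 * g.1 1 0 = 1 := (Matrix.det_fin_two g.1).symm.trans hd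
  rw [e1, e3] at hd
  refine ⟨(g.1 0 0).re, (g.1 0 0).im, (g.1 0 1).re, (g.1 0 1).im, ?_, ?_⟩
  · have := congrArg Complex.re hd
    simp at this
    linarith
  · ext i j
    fin_cases i <;> fin_cases j <;> simp [e1, e3, Complex.ext_iff]

theorem adMatrix_entries (a b c d : ℝ) :
    adMatrix !![⟨a, b⟩, ⟨c, d⟩; ⟨-c, d⟩, ⟨a, -b⟩] =
      !![a ^ 2 + b ^ 2 - c ^ 2 - d ^ 2, 2 * (b * c - a * d), 2 * (b * d + a * c);
         2 * (b * c + a * d), a ^ 2 - b ^ 2 + c ^ 2 - d ^ 2, 2 * (c * d - a * b);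
         2 * (b * d - a * c), 2 * (c * d + a * b), a ^ 2 - b ^ 2 - c ^ 2 + d ^ 2] := by
  have hs : (!![⟨a, b⟩, ⟨c, d⟩; ⟨-c, d⟩, ⟨a, -b⟩] : Matrix (Fin 2) (Fin 2) ℂ).conjTranspose =
      !![⟨a, -b⟩, ⟨-c, -d⟩; ⟨c, -d⟩, ⟨a, b⟩] := by
    ext i j
    fin_cases i <;> fin_cases j <;> simp [Complex.ext_iff]
  ext i j
  rw [adMatrix, hs]
  fin_cases i <;> fin_cases j <;>
    simp [quatUnit, Matrix.trace, Matrix.mul_apply, Fin.sum_univ_two] <;> ring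

theorem adMatrix_mul (g h : SU2) : adMatrix (g * h).1 = adMatrix g.1 * adMatrix h.1 := by
  obtain ⟨a, b, c, d, -, hg⟩ := su2_entries g
  obtain ⟨a', b', c', d', -, hh⟩ := su2_entries h
  have hgh : (g * h).1 = !![⟨a * a' - b * b' - c * c' - d * d', a * b' + b * a' + c * d' - d * c'⟩,
      ⟨a * c' + c * a' + d * b' - b * d', a * d' + d * a' + b * c' - c * b'⟩;
      ⟨-(a * c' + c * a' + d * b' - b * d'), a * d' + d * a' + b * c' - c * b'⟩,
      ⟨a * a' - b * b' - c * c' - d * d', -(a * b' + b * a' + c * d' - d * c')⟩] := by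
    rw [Submonoid.coe_mul, hg, hh]
    ext i j
    fin_cases i <;> fin_cases j <;> simp [Complex.ext_iff] <;> constructor <;> ring
  rw [hgh, hg, hh]
  simp only [adMatrix_entries]
  ext i j
  fin_cases i <;> fin_cases j <;> simp [Matrix.mul_apply, Fin.sum_univ_three] <;> ring

theorem adMatrix_mem (g : SU2) : adMatrix g.1 ∈ Matrix.specialOrthogonalGroup (Fin 3) ℝ := by
  obtain ⟨a, b, c, d, h1, hg⟩ := su2_entries g
  have ha : a ^ 2 = 1 - b ^ 2 - c ^ 2 - d ^ 2 := by linarith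
  rw [hg, adMatrix_entries, Matrix.mem_specialOrthogonalGroup_iff, Matrix.mem_orthogonalGroup_iff]
  constructor
  · ext i j
    fin_cases i <;> fin_cases j <;> simp [Matrix.mul_apply, Fin.sum_univ_three] <;> grind
  · rw [Matrix.det_fin_three]
    simp
    grind

/-- The double covering `SU(2) → SO(3)`, given by the conjugation action of `SU(2)` on purely
quaternionic matrices. -/
noncomputable def coveringHom : SU2 →* SO3 where
  toFun g := ⟨adMatrix g.1, adMatrix_mem g⟩
  map_one' := by
    apply Subtype.ext
    have h : (1 : Matrix (Fin 2) (Fin 2) ℂ) = !![⟨1, 0⟩, ⟨0, 0⟩; ⟨-0, 0⟩, ⟨1, -0⟩] := by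
      ext i j
      fin_cases i <;> fin_cases j <;> simp [Complex.ext_iff]
    change adMatrix 1 = 1
    rw [h, adMatrix_entries]
    ext i j
    fin_cases i <;> fin_cases j <;> simp
  map_mul' g h := Subtype.ext (adMatrix_mul g h)

/-- `rotSU w θ` is the element of `SU(2)` (as a matrix) lying over the counter-clockwise rotation
about the unit vector `w` by the angle `θ`, where `θ` counts modulo `4 π`. -/
noncomputable def rotSU (w : EuclideanSpace ℝ (Fin 3)) (θ : ℝ) : Matrix (Fin 2) (Fin 2) ℂ :=
  (Real.cos (θ / 2) : ℂ) • (1 : Matrix (Fin 2) (Fin 2) ℂ) + (Real.sin (θ / 2) : ℂ) • pureQuat w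

/-! ### The tetrahedron and its Klein four-group -/

/-- The solid regular tetrahedron with vertices `(π, 0, 0)`, `(0, π, 0)`, `(0, 0, π)` and
`(π, π, π)`. -/
def tetrahedron : Set (EuclideanSpace ℝ (Fin 3)) :=
  {x | Real.pi ≤ x 0 + x 1 + x 2 ∧ x 1 + x 2 - Real.pi ≤ x 0 ∧
    x 0 + x 2 - Real.pi ≤ x 1 ∧ x 0 + x 1 - Real.pi ≤ x 2}

/-- Half-turn about the line through `(π/2, π/2, π/2)` parallel to the `i`-th coordinate axis. -/
noncomputable def halfTurnMap (i : Fin 3) (x : tetrahedron) : tetrahedron :=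
  ⟨WithLp.toLp 2 (fun j => if j = i then x.1 j else Real.pi - x.1 j), by
    obtain ⟨x, h⟩ := x
    obtain ⟨h0, h1, h2, h3⟩ := h
    fin_cases i <;> refine ⟨?_, ?_, ?_, ?_⟩ <;> simp <;> linarith⟩

theorem halfTurnMap_apply (i : Fin 3) (x : tetrahedron) (j : Fin 3) :
    (halfTurnMap i x).1 j = if j = i then x.1 j else Real.pi - x.1 j := rfl

theorem tetrahedron_ext {x y : tetrahedron} (h : ∀ j, x.1 j = y.1 j) : x = y :=
  Subtype.ext (PiLp.ext h)

theorem halfTurnMap_involutive (i : Fin 3) : Function.Involutive (halfTurnMap i) := fun x =>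
  tetrahedron_ext fun j => by
    simp only [halfTurnMap_apply]
    split_ifs <;> ring

/-- The involutions `I_A`, `I_B`, `I_C` of the tetrahedron (for `i = 0, 1, 2`), as isometries. -/
noncomputable def halfTurn (i : Fin 3) : tetrahedron ≃ᵢ tetrahedron where
  toEquiv := (halfTurnMap_involutive i).toPerm
  isometry_toFun := Isometry.of_dist_eq fun x y => by
    change dist (halfTurnMap i x).1 (halfTurnMap i y).1 = dist x.1 y.1
    simp only [EuclideanSpace.dist_eq, halfTurnMap_apply]
    congr 1
    refine Finset.sum_congr rfl fun j _ => ?_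
    split_ifs
    · rfl
    · rw [dist_sub_left]

theorem halfTurn_apply (i : Fin 3) (x : tetrahedron) (j : Fin 3) :
    (halfTurn i x).1 j = if j = i then x.1 j else Real.pi - x.1 j := rfl

theorem halfTurn_mul_self (i : Fin 3) : halfTurn i * halfTurn i = 1 :=
  IsometryEquiv.ext fun x => halfTurnMap_involutive i x

theorem halfTurn_mul {i j k : Fin 3} (hij : i ≠ j) (hik : i ≠ k) (hjk : j ≠ k) :
    halfTurn i * halfTurn j = halfTurn k := by
  refine IsometryEquiv.ext fun x => tetrahedron_ext fun l => ?_
  change (halfTurn i (halfTurn j x)).1 l = _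
  simp only [halfTurn_apply]
  have : l = i ∨ l = j ∨ l = k := by omega
  rcases this with rfl | rfl | rfl <;> simp [hij, hik, hjk, hij.symm, hik.symm, hjk.symm]

/-- The group `V = {1, I_A, I_B, I_C}` of isometries of the tetrahedron. -/
noncomputable def kleinV : Subgroup (tetrahedron ≃ᵢ tetrahedron) where
  carrier := {v | v = 1 ∨ ∃ i, v = halfTurn i}
  one_mem' := Or.inl rfl
  mul_mem' := by
    rintro _ _ (rfl | ⟨i, rfl⟩) (rfl | ⟨j, rfl⟩)
    · exact Or.inl rfl
    · exact Or.inr ⟨j, one_mul _⟩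
    · exact Or.inr ⟨i, mul_one _⟩
    · by_cases h : i = j
      · subst h
        exact Or.inl (halfTurn_mul_self i)
      · obtain ⟨k, h1, h2⟩ : ∃ k : Fin 3, i ≠ k ∧ j ≠ k := by decide +revert
        exact Or.inr ⟨k, halfTurn_mul h h1 h2⟩
  inv_mem' := by
    rintro _ (rfl | ⟨i, rfl⟩)
    · exact Or.inl inv_one
    · exact Or.inr ⟨i, inv_eq_of_mul_eq_one_left (halfTurn_mul_self i)⟩

/-- The group `V` acts on the tetrahedron by evaluation. -/
noncomputable instance kleinVAction : MulAction kleinV tetrahedron where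
  smul v x := v.1 x
  one_smul _ := rfl
  mul_smul _ _ _ := rfl

/-- The axis of the `i`-th of the involutions `I_A`, `I_B`, `I_C`: the maximal segment of the
tetrahedron that it fixes. -/
def axis (i : Fin 3) : Set tetrahedron := {x | halfTurn i x = x}

/-! ### Branched coverings -/

/-- `f` is an `n`-to-one branched covering with branch locus `B` (a subset of the source): it is a
continuous open and closed surjection with finite fibres, it is an `n`-to-one covering map away
from the closed, nowhere dense set `B`, which is a union of fibres, and it is not locally injective
at any point of `B`. -/
structure IsBranchedCovering {X Y : Type*} [TopologicalSpace X] [TopologicalSpace Y] (n : ℕ)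
    (f : X → Y) (B : Set X) : Prop where
  continuous : Continuous f
  surjective : Function.Surjective f
  isOpenMap : IsOpenMap f
  isClosedMap : IsClosedMap f
  finite_fibre : ∀ y, (f ⁻¹' {y}).Finite
  isClosed_branch : IsClosed B
  dense_compl_branch : Dense Bᶜ
  saturated_branch : f ⁻¹' (f '' B) = B
  isCoveringMapOn : IsCoveringMapOn f (f '' B)ᶜ
  card_fibre : ∀ y ∉ f '' B, (f ⁻¹' {y}).ncard = n
  not_locally_injective : ∀ x ∈ B, ∀ U ∈ 𝓝 x, ¬ Set.InjOn f U

/-! Since CBA = 1 determines C, the group is free on A and B, and an `SU2`-character is a pair of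
unit quaternions up to simultaneous conjugation. Such a pair is determined by the real parts of A, B
and BA (`exists_conj_of_su2Re_eq`), that is, by angles α, β, γ in [0, π] with these cosines.
Splitting quaternions into scalar and vector parts gives cos γ = cos α cos β − t sin α sin β, where
t is the cosine of the angle between the two axes. As t can be anything in [−1, 1], the only
constraint is cos(α + β) ≤ cos γ ≤ cos(α − β); with θ₂ = π − γ this is the system of four face
inequalities of the tetrahedron. So the angles define a continuous bijection from a compact space
onto a Hausdorff one, hence a homeomorphism.

Every homomorphism to `SO3` lifts, again by freeness, and two lifts differ by signs on A and B. The
sign of C is then the product of these two, and changing the sign of a generator replaces its θ by π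
− θ. So the four sign choices act on angles as V, and the fibres of the map from the tetrahedron to
the `SO3`-characters are the V-orbits (`angleToSO3_eq_iff`). That map is a quotient map by
compactness. The rest is a general fact on finite groups acting freely on a dense set
(`isBranchedCovering_of_finite_group`): here the points with nontrivial stabilizer form the three
axes. -/

open Topology

/-! ### Elements of `SU(2)` by real coordinates -/

/-- The matrix of the quaternion `a + b i + c j + d k`. -/
def quatMat (a b c d : ℝ) : Matrix (Fin 2) (Fin 2) ℂ := !![⟨a, b⟩, ⟨c, d⟩; ⟨-c, d⟩, ⟨a, -b⟩]

theorem quatMat_mul (a b c d a' b' c' d' : ℝ) :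
    quatMat a b c d * quatMat a' b' c' d' =
      quatMat (a * a' - b * b' - c * c' - d * d') (a * b' + b * a' + c * d' - d * c')
        (a * c' + c * a' + d * b' - b * d') (a * d' + d * a' + b * c' - c * b') := by
  ext i j
  fin_cases i <;> fin_cases j <;> simp [quatMat, Complex.ext_iff] <;> constructor <;> ring

theorem quatMat_inj {a b c d a' b' c' d' : ℝ} (h : quatMat a b c d = quatMat a' b' c' d') :
    a = a' ∧ b = b' ∧ c = c' ∧ d = d' := by
  have h0 := congrFun (congrFun h 0) 0
  have h1 := congrFun (congrFun h 0) 1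
  simp [quatMat, Complex.ext_iff] at h0 h1
  exact ⟨h0.1, h0.2, h1.1, h1.2⟩

theorem quatMat_star (a b c d : ℝ) : star (quatMat a b c d) = quatMat a (-b) (-c) (-d) := by
  ext i j
  fin_cases i <;> fin_cases j <;> simp [quatMat, Complex.ext_iff]

theorem quatMat_one : quatMat 1 0 0 0 = 1 := by
  ext i j
  fin_cases i <;> fin_cases j <;> simp [quatMat, Complex.ext_iff]

theorem quatMat_neg (a b c d : ℝ) : -quatMat a b c d = quatMat (-a) (-b) (-c) (-d) := by
  ext i j
  fin_cases i <;> fin_cases j <;> simp [quatMat, Complex.ext_iff]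

/-- The unit quaternion `a + b i + c j + d k` as an element of `SU(2)`. -/
def quatSU (a b c d : ℝ) (h : a ^ 2 + b ^ 2 + c ^ 2 + d ^ 2 = 1) : SU2 :=
  ⟨quatMat a b c d, by
    rw [Matrix.mem_specialUnitaryGroup_iff, Matrix.mem_unitaryGroup_iff, quatMat_star, quatMat_mul,
      ← quatMat_one]
    constructor
    · congr 1 <;> linarith
    · simp only [quatMat, Matrix.det_fin_two_of, Complex.ext_iff]
      constructor
      · simp
        linarith
      · simp
        ring⟩

theorem exists_quatSU (g : SU2) : ∃ a b c d h, g = quatSU a b c d h := by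
  obtain ⟨a, b, c, d, h, hg⟩ := su2_entries g
  exact ⟨a, b, c, d, h, Subtype.ext hg⟩

/-- The real part of a unit quaternion. -/
def su2Re (g : SU2) : ℝ := (g.1 0 0).re

theorem su2Re_quatSU (a b c d : ℝ) (h) : su2Re (quatSU a b c d h) = a := rfl

theorem su2Re_mul_quatSU (a b c d a' b' c' d' : ℝ) (h h') :
    su2Re (quatSU a b c d h * quatSU a' b' c' d' h') = a * a' - b * b' - c * c' - d * d' := by
  change ((quatMat _ _ _ _ * quatMat _ _ _ _) 0 0).re = _
  rw [quatMat_mul]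
  rfl

theorem su2Re_eq_trace (g : SU2) : su2Re g = g.1.trace.re / 2 := by
  obtain ⟨a, b, c, d, h, rfl⟩ := exists_quatSU g
  simp [su2Re, quatSU, quatMat, Matrix.trace_fin_two]

theorem su2Re_mul_comm (g k : SU2) : su2Re (g * k) = su2Re (k * g) := by
  rw [su2Re_eq_trace, su2Re_eq_trace, Submonoid.coe_mul, Submonoid.coe_mul, Matrix.trace_mul_comm]

theorem su2Re_conj (k g : SU2) : su2Re (k * g * k⁻¹) = su2Re g := by
  rw [su2Re_mul_comm, inv_mul_cancel_left]

theorem su2Re_inv (g : SU2) : su2Re g⁻¹ = su2Re g := by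
  rw [← Matrix.star_eq_inv]
  obtain ⟨a, b, c, d, h, rfl⟩ := exists_quatSU g
  simp [su2Re, quatSU, quatMat]

theorem continuous_su2Re : Continuous su2Re :=
  Complex.continuous_re.comp (continuous_subtype_val.matrix_elem 0 0)

/-! ### Conjugacy of elements and of pairs in `SU2` -/

theorem conj_eq_of_mul_eq {G : Type*} [Group G] {k g x : G} (h : k * g = x * k) :
    k * g * k⁻¹ = x := by
  rw [h, mul_inv_cancel_right]

/-- Every element of `SU(2)` is conjugate to `a + r i` with `0 ≤ r`. -/
theorem exists_conj_eq_diag (g : SU2) :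
    ∃ k : SU2, ∃ a r h, 0 ≤ r ∧ k * g * k⁻¹ = quatSU a r 0 0 h := by
  obtain ⟨a, b, c, d, h, rfl⟩ := exists_quatSU g
  have h0 : 0 ≤ b ^ 2 + c ^ 2 + d ^ 2 := by positivity
  obtain ⟨r, hr0, hr⟩ : ∃ r : ℝ, 0 ≤ r ∧ r ^ 2 = b ^ 2 + c ^ 2 + d ^ 2 :=
    ⟨√(b ^ 2 + c ^ 2 + d ^ 2), Real.sqrt_nonneg _, Real.sq_sqrt h0⟩
  have har : a ^ 2 + r ^ 2 + 0 ^ 2 + 0 ^ 2 = 1 := by linarith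
  -- For v = bi + cj + dk, the quaternion r − iv = (r + b) + dj − ck satisfies (r − iv)v = ri(r −
  -- iv), so its normalization conjugates v to ri. It vanishes exactly when v = −ri, and then j does
  -- the job.
  rcases eq_or_ne ((r + b) ^ 2 + d ^ 2 + c ^ 2) 0 with hn | hn
  · have hc : c = 0 := by nlinarith [sq_nonneg (r + b), sq_nonneg c, sq_nonneg d]
    have hd : d = 0 := by nlinarith [sq_nonneg (r + b), sq_nonneg c, sq_nonneg d]
    have hb : r + b = 0 := by nlinarith [sq_nonneg (r + b), sq_nonneg c, sq_nonneg d]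
    subst hc hd
    refine ⟨quatSU 0 0 1 0 (by norm_num), a, r, har, hr0, conj_eq_of_mul_eq (Subtype.ext ?_)⟩
    simp only [quatSU, Submonoid.coe_mul, quatMat_mul]
    congr 1 <;> linarith
  · have hpos : 0 < (r + b) ^ 2 + d ^ 2 + c ^ 2 := lt_of_le_of_ne (by positivity) hn.symm
    obtain ⟨n, hn0, hn2⟩ : ∃ n : ℝ, 0 < n ∧ n ^ 2 = (r + b) ^ 2 + d ^ 2 + c ^ 2 :=
      ⟨√((r + b) ^ 2 + d ^ 2 + c ^ 2), Real.sqrt_pos.2 hpos, Real.sq_sqrt hpos.le⟩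
    refine ⟨quatSU ((r + b) / n) 0 (d / n) (-c / n) ?_, a, r, har, hr0,
      conj_eq_of_mul_eq (Subtype.ext ?_)⟩
    · field_simp
      linarith
    · simp only [quatSU, Submonoid.coe_mul, quatMat_mul]
      congr 1 <;> field_simp <;> linarith

/-- For real `c`, `d` there is a unit complex number whose square turns `c + d i` into a
nonnegative real number. -/
theorem exists_sq_rotation (c d : ℝ) : ∃ x y s : ℝ, x ^ 2 + y ^ 2 = 1 ∧ 0 ≤ s ∧
    x * c - y * d = s * x ∧ x * d + y * c = -(s * y) := by
  have h := Complex.norm_mul_cos_add_sin_mul_I (⟨c, d⟩ : ℂ)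
  set s := ‖(⟨c, d⟩ : ℂ)‖
  set t := Complex.arg ⟨c, d⟩
  have hc : c = s * Real.cos t := by
    have := congrArg Complex.re h
    simpa [← Complex.ofReal_cos, ← Complex.ofReal_sin, mul_add, Complex.ext_iff] using this.symm
  have hd : d = s * Real.sin t := by
    have := congrArg Complex.im h
    simpa [← Complex.ofReal_cos, ← Complex.ofReal_sin, mul_add, Complex.ext_iff] using this.symm
  -- With x + yi = exp(−iu), half the argument is removed: (x + yi)(c + di) = s(x − yi), which is
  -- what the two equations say.
  obtain ⟨u, hu⟩ : ∃ u, t = 2 * u := ⟨t / 2, by ring⟩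
  have h1 := Real.sin_sq_add_cos_sq u
  rw [hu] at hc hd
  rw [Real.cos_two_mul'] at hc
  rw [Real.sin_two_mul] at hd
  refine ⟨Real.cos u, -Real.sin u, s, by linarith, norm_nonneg _, ?_, ?_⟩
  · rw [hc, hd]
    linear_combination s * Real.cos u * h1
  · rw [hc, hd]
    linear_combination s * Real.sin u * h1

/-- Normal form of a pair of elements of `SU(2)` up to simultaneous conjugation. -/
theorem exists_conj_pair (g h : SU2) : ∃ k : SU2, ∃ a r hg a' b' c' hh, 0 ≤ r ∧ 0 ≤ c' ∧
    (r = 0 → c' = 0 ∧ 0 ≤ b') ∧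
    k * g * k⁻¹ = quatSU a r 0 0 hg ∧ k * h * k⁻¹ = quatSU a' b' c' 0 hh := by
  obtain ⟨k, a, r, hg, hr, hk⟩ := exists_conj_eq_diag g
  -- If r = 0 then g is central and only h has to be normalized.
  rcases eq_or_ne r 0 with h0 | h0
  · subst h0
    obtain ⟨l, a', r', hh, hr', hl⟩ := exists_conj_eq_diag (k * h * k⁻¹)
    refine ⟨l * k, a, 0, hg, a', r', 0, hh, le_rfl, le_rfl, fun _ => ⟨rfl, hr'⟩, ?_, ?_⟩
    · have e : l * k * g * (l * k)⁻¹ = l * (k * g * k⁻¹) * l⁻¹ := by group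
      rw [e, hk]
      obtain ⟨x, y, z, w, hl, rfl⟩ := exists_quatSU l
      refine conj_eq_of_mul_eq (Subtype.ext ?_)
      simp only [quatSU, Submonoid.coe_mul, quatMat_mul]
      congr 1 <;> ring
    · rw [← hl]
      group
  -- Elements x + yi commute with a + ri, and conjugation by a unit x + yi multiplies the factor c +
  -- di of cj + dk = (c + di)j by (x + yi)².
  · obtain ⟨a', b', c, d, hh, hk'⟩ := exists_quatSU (k * h * k⁻¹)
    obtain ⟨x, y, s, hxy, hs, e1, e2⟩ := exists_sq_rotation c d
    have hcd : c ^ 2 + d ^ 2 = s ^ 2 := by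
      linear_combination (-c ^ 2 - d ^ 2 + s ^ 2) * hxy + (x * c - y * d + s * x) * e1 +
        (x * d + y * c - s * y) * e2
    have hl : x ^ 2 + y ^ 2 + 0 ^ 2 + 0 ^ 2 = 1 := by linarith
    refine ⟨quatSU x y 0 0 hl * k, a, r, hg, a', b', s, by linarith, hr, hs,
      fun h => absurd h h0, ?_, ?_⟩
    · have e : quatSU x y 0 0 hl * k * g * (quatSU x y 0 0 hl * k)⁻¹ =
        quatSU x y 0 0 hl * (k * g * k⁻¹) * (quatSU x y 0 0 hl)⁻¹ := by group
      rw [e, hk]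
      refine conj_eq_of_mul_eq (Subtype.ext ?_)
      simp only [quatSU, Submonoid.coe_mul, quatMat_mul]
      congr 1 <;> ring
    · have e : quatSU x y 0 0 hl * k * h * (quatSU x y 0 0 hl * k)⁻¹ =
        quatSU x y 0 0 hl * (k * h * k⁻¹) * (quatSU x y 0 0 hl)⁻¹ := by group
      rw [e, hk']
      refine conj_eq_of_mul_eq (Subtype.ext ?_)
      simp only [quatSU, Submonoid.coe_mul, quatMat_mul]
      congr 1 <;> linarith

/-- Pairs of elements of `SU(2)` are determined up to conjugation by three traces. -/
theorem exists_conj_of_su2Re_eq {g h g' h' : SU2} (h1 : su2Re g = su2Re g')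
    (h2 : su2Re h = su2Re h') (h3 : su2Re (h * g) = su2Re (h' * g')) :
    ∃ k : SU2, g' = k * g * k⁻¹ ∧ h' = k * h * k⁻¹ := by
  obtain ⟨k, a, r, hg, p, q, s, hh, hr, hs, h0, e1, e2⟩ := exists_conj_pair g h
  obtain ⟨k', a', r', hg', p', q', s', hh', hr', hs', h0', e1', e2'⟩ := exists_conj_pair g' h'
  rw [← su2Re_conj k, e1, ← su2Re_conj k' g', e1', su2Re_quatSU, su2Re_quatSU] at h1
  rw [← su2Re_conj k, e2, ← su2Re_conj k' h', e2', su2Re_quatSU, su2Re_quatSU] at h2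
  have e3 : k * (h * g) * k⁻¹ = (k * h * k⁻¹) * (k * g * k⁻¹) := by group
  have e3' : k' * (h' * g') * k'⁻¹ = (k' * h' * k'⁻¹) * (k' * g' * k'⁻¹) := by group
  rw [← su2Re_conj k, e3, e1, e2, ← su2Re_conj k' (h' * g'), e3', e1', e2'] at h3
  have h3 : p * a - q * r - s * 0 - 0 * 0 = p' * a' - q' * r' - s' * 0 - 0 * 0 := by
    rwa [su2Re_mul_quatSU, su2Re_mul_quatSU] at h3
  subst h1 h2
  obtain rfl : r = r' := (sq_eq_sq₀ hr hr').1 (by linarith)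
  -- The third real part gives qr = q'r, and the norm gives s from q. When r = 0 this leaves q free,
  -- whence the extra clause in the normal form.
  have hq : q = q' ∧ s = s' := by
    rcases eq_or_ne r 0 with h | h
    · obtain ⟨rfl, hq⟩ := h0 h
      obtain ⟨rfl, hq'⟩ := h0' h
      exact ⟨(sq_eq_sq₀ hq hq').1 (by linarith), rfl⟩
    · obtain rfl : q = q' := mul_right_cancel₀ h (by linarith)
      exact ⟨rfl, (sq_eq_sq₀ hs hs').1 (by linarith)⟩
  obtain ⟨rfl, rfl⟩ := hq
  refine ⟨k'⁻¹ * k, ?_, ?_⟩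
  · rw [← e1'] at e1
    have e : k'⁻¹ * k * g * (k'⁻¹ * k)⁻¹ = k'⁻¹ * (k * g * k⁻¹) * k' := by group
    rw [e, e1]
    group
  · rw [← e2'] at e2
    have e : k'⁻¹ * k * h * (k'⁻¹ * k)⁻¹ = k'⁻¹ * (k * h * k⁻¹) * k' := by group
    rw [e, e2]
    group

/-! ### The double covering -/

theorem coveringHom_coe (a b c d : ℝ) (h) : (coveringHom (quatSU a b c d h)).1 =
    !![a ^ 2 + b ^ 2 - c ^ 2 - d ^ 2, 2 * (b * c - a * d), 2 * (b * d + a * c);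
       2 * (b * c + a * d), a ^ 2 - b ^ 2 + c ^ 2 - d ^ 2, 2 * (c * d - a * b);
       2 * (b * d - a * c), 2 * (c * d + a * b), a ^ 2 - b ^ 2 - c ^ 2 + d ^ 2] :=
  adMatrix_entries a b c d

/-- The element `-1` of `SU(2)`. -/
def negOneSU : SU2 := quatSU (-1) 0 0 0 (by norm_num)

theorem negOneSU_mul_quatSU (a b c d : ℝ) (h) :
    negOneSU * quatSU a b c d h = quatSU (-a) (-b) (-c) (-d) (by linarith) := by
  refine Subtype.ext ?_
  simp only [negOneSU, quatSU, Submonoid.coe_mul, quatMat_mul]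
  congr 1 <;> ring

theorem su2Re_negOneSU_mul (g : SU2) : su2Re (negOneSU * g) = -su2Re g := by
  obtain ⟨a, b, c, d, h, rfl⟩ := exists_quatSU g
  rw [negOneSU_mul_quatSU, su2Re_quatSU, su2Re_quatSU]

theorem negOneSU_mul_self : negOneSU * negOneSU = 1 := by
  refine Subtype.ext ?_
  simp only [negOneSU, quatSU, Submonoid.coe_mul, quatMat_mul]
  rw [Submonoid.coe_one, ← quatMat_one]
  congr 1 <;> ring

theorem negOneSU_mul_comm (g : SU2) : g * negOneSU = negOneSU * g := by
  obtain ⟨a, b, c, d, h, rfl⟩ := exists_quatSU g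
  refine Subtype.ext ?_
  simp only [negOneSU, quatSU, Submonoid.coe_mul, quatMat_mul]
  congr 1 <;> ring

theorem coveringHom_negOneSU : coveringHom negOneSU = 1 := by
  refine Subtype.ext ?_
  rw [negOneSU, coveringHom_coe]
  ext i j
  fin_cases i <;> fin_cases j <;> simp

theorem eq_or_of_coveringHom_eq_one {g : SU2} (hg : coveringHom g = 1) :
    g = 1 ∨ g = negOneSU := by
  obtain ⟨a, b, c, d, h, rfl⟩ := exists_quatSU g
  have hg := congrArg Subtype.val hg
  rw [coveringHom_coe] at hg
  have e0 := congrFun (congrFun hg 0) 0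
  have e1 := congrFun (congrFun hg 1) 1
  have e2 := congrFun (congrFun hg 2) 2
  simp at e0 e1 e2
  have hb : b = 0 := by nlinarith [sq_nonneg b, sq_nonneg c, sq_nonneg d]
  have hc : c = 0 := by nlinarith [sq_nonneg b, sq_nonneg c, sq_nonneg d]
  have hd : d = 0 := by nlinarith [sq_nonneg b, sq_nonneg c, sq_nonneg d]
  subst hb hc hd
  have : a = 1 ∨ a = -1 := eq_or_eq_neg_of_sq_eq_sq a 1 (by linarith)
  rcases this with rfl | rfl
  · exact Or.inl (Subtype.ext quatMat_one)
  · exact Or.inr rfl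

theorem eq_or_of_coveringHom_eq {g h : SU2} (hgh : coveringHom g = coveringHom h) :
    g = h ∨ g = negOneSU * h := by
  have : coveringHom (g * h⁻¹) = 1 := by rw [map_mul, map_inv, hgh, mul_inv_cancel]
  rcases eq_or_of_coveringHom_eq_one this with e | e
  · exact Or.inl (mul_inv_eq_one.1 e)
  · exact Or.inr (mul_inv_eq_iff_eq_mul.1 e)

/-- As a pure unit quaternion, v is conjugate to i: the real part stays 0, which forces r = 1. -/
theorem exists_coveringHom_mulVec (v : Fin 3 → ℝ) (hv : v 0 ^ 2 + v 1 ^ 2 + v 2 ^ 2 = 1) :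
    ∃ k : SU2, (coveringHom k).1.mulVec v = ![1, 0, 0] := by
  obtain ⟨k, a, r, h, hr, hk⟩ := exists_conj_eq_diag (quatSU 0 (v 0) (v 1) (v 2) (by linarith))
  have ha : a = 0 := by
    rw [← su2Re_quatSU a r 0 0 h, ← hk, su2Re_conj, su2Re_quatSU]
  subst ha
  obtain rfl : r = 1 := (sq_eq_sq₀ hr zero_le_one).1 (by linarith)
  obtain ⟨a, b, c, d, hn, rfl⟩ := exists_quatSU k
  rw [mul_inv_eq_iff_eq_mul] at hk
  have hk := congrArg Subtype.val hk
  simp only [quatSU, Submonoid.coe_mul, quatMat_mul] at hk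
  obtain ⟨e1, e2, e3, e4⟩ := quatMat_inj hk
  refine ⟨quatSU a b c d hn, ?_⟩
  · rw [coveringHom_coe]
    ext i
    fin_cases i <;> simp [Matrix.mulVec, dotProduct, Fin.sum_univ_three]
    -- The combinations are the coordinates of k v k̄ = i, obtained from kv = ik by right
    -- multiplication with k̄.
    · linear_combination -b * e1 + a * e2 - d * e3 + c * e4 + hn
    · linear_combination -c * e1 + a * e3 - b * e4 + d * e2
    · linear_combination -d * e1 + a * e4 - c * e2 + b * e3

/-- Orthogonality and determinant 1 make R a rotation by some φ about the first axis, which lifts to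
exp(iφ/2). -/
theorem mem_range_coveringHom_of_col {R : SO3} (h0 : R.1 0 0 = 1) (h1 : R.1 1 0 = 0)
    (h2 : R.1 2 0 = 0) : ∃ g, coveringHom g = R := by
  obtain ⟨ho, hd⟩ := Matrix.mem_specialOrthogonalGroup_iff.1 R.2
  have ho := (Matrix.mem_orthogonalGroup_iff _ _).1 ho
  rw [Matrix.det_fin_three, h0, h1, h2] at hd
  have e00 := congrFun (congrFun ho 0) 0
  have e11 := congrFun (congrFun ho 1) 1
  have e12 := congrFun (congrFun ho 1) 2
  have e22 := congrFun (congrFun ho 2) 2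
  simp [Matrix.mul_apply, Fin.sum_univ_three, h0, h1, h2] at e00 e11 e12 e22
  have f1 : R.1 0 1 = 0 := by nlinarith [sq_nonneg (R.1 0 1), sq_nonneg (R.1 0 2)]
  have f2 : R.1 0 2 = 0 := by nlinarith [sq_nonneg (R.1 0 1), sq_nonneg (R.1 0 2)]
  rw [f1, f2] at hd
  have f3 : R.1 2 2 = R.1 1 1 := by
    linear_combination R.1 1 1 * hd - R.1 2 2 * e11 + R.1 1 2 * e12
  have f4 : R.1 1 2 = -R.1 2 1 := by
    linear_combination -R.1 1 2 * e22 - R.1 2 1 * hd + R.1 2 2 * e12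
  rw [f4] at e11
  obtain ⟨x, y, s, hxy, hs, g1, g2⟩ := exists_sq_rotation (R.1 1 1) (R.1 2 1)
  have hs1 : s ^ 2 = 1 := by
    linear_combination (-R.1 1 1 ^ 2 - R.1 2 1 ^ 2 + s ^ 2) * (-hxy) +
      (-1) * (x * R.1 1 1 - y * R.1 2 1 + s * x) * g1 -
        (x * R.1 2 1 + y * R.1 1 1 - s * y) * g2 + e11
  obtain rfl : s = 1 := (sq_eq_sq₀ hs zero_le_one).1 (by linarith)
  have g3 : R.1 1 1 = x ^ 2 - y ^ 2 := by
    linear_combination -R.1 1 1 * hxy + x * g1 + y * g2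
  have g4 : R.1 2 1 = -2 * x * y := by
    linear_combination -R.1 2 1 * hxy - y * g1 + x * g2
  -- The square of x + yi is the inverse of cos φ + i sin φ, so its conjugate is the half-angle
  -- lift.
  refine ⟨quatSU x (-y) 0 0 (by linarith), Subtype.ext ?_⟩
  rw [coveringHom_coe]
  ext i j
  fin_cases i <;> fin_cases j <;> simp [h0, h1, h2, f1, f2, f3, f4, g3, g4] <;> linarith

/-- A lifted rotation carrying the first column of R to the first basis vector reduces to the
preceding case. -/
theorem coveringHom_surjective : Function.Surjective coveringHom := by
  intro R
  have ho := (Matrix.mem_orthogonalGroup_iff' _ _).1 (Matrix.mem_specialOrthogonalGroup_iff.1 R.2).1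
  have e00 := congrFun (congrFun ho 0) 0
  simp [Matrix.mul_apply, Fin.sum_univ_three] at e00
  obtain ⟨k, hk⟩ := exists_coveringHom_mulVec (fun i => R.1 i 0) (by linarith)
  have hcol (i : Fin 3) : (coveringHom k * R).1 i 0 = ![(1 : ℝ), 0, 0] i := congrFun hk i
  obtain ⟨g, hg⟩ := mem_range_coveringHom_of_col (hcol 0) (hcol 1) (hcol 2)
  exact ⟨k⁻¹ * g, by rw [map_mul, map_inv, hg, inv_mul_cancel_left]⟩

theorem continuous_coveringHom : Continuous coveringHom := by
  refine Continuous.subtype_mk (continuous_matrix fun i j => ?_) _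
  have h : Continuous fun g : SU2 => quatUnit i * (g.1 * quatUnit j * g.1.conjTranspose) := by
    fun_prop
  exact continuous_const.mul (Complex.continuous_re.comp h.matrix_trace)

instance compactSpace_SU2 : CompactSpace SU2 := by
  refine isCompact_iff_compactSpace.1 (?_ : IsCompact
    (Matrix.specialUnitaryGroup (Fin 2) ℂ : Set (Matrix (Fin 2) (Fin 2) ℂ)))
  have hK : IsCompact (Set.univ.pi fun _ => Set.univ.pi fun _ => Metric.closedBall 0 1 :
      Set (Matrix (Fin 2) (Fin 2) ℂ)) :=
    isCompact_univ_pi fun _ : Fin 2 => isCompact_univ_pi fun _ : Fin 2 =>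
      isCompact_closedBall (0 : ℂ) 1
  refine hK.of_isClosed_subset ?_ fun M hM i _ j _ => ?_
  · have : (Matrix.specialUnitaryGroup (Fin 2) ℂ : Set (Matrix (Fin 2) (Fin 2) ℂ)) =
        {M | M * star M = 1} ∩ {M | M.det = 1} := by
      ext M
      simp [Matrix.mem_specialUnitaryGroup_iff, Matrix.mem_unitaryGroup_iff]
    rw [this]
    exact (isClosed_eq (by fun_prop) continuous_const).inter
      (isClosed_eq (by fun_prop) continuous_const)
  · rw [mem_closedBall_zero_iff]
    exact entry_norm_bound_of_unitary (Matrix.mem_specialUnitaryGroup_iff.1 hM).1 i j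

/-! ### Spaces of representations -/

section Hom

variable {Γ H K : Type*} [Group Γ] [Group H] [Group K]

theorem CharSpace.mk_eq_mk {f f' : Γ →* H} :
    CharSpace.mk f = CharSpace.mk f' ↔ ∃ g : H, ∀ γ : Γ, f' γ = g * f γ * g⁻¹ :=
  Quotient.eq (r := conjSetoid Γ H)

theorem CharSpace.map_mk (φ : H →* K) (f : Γ →* H) :
    CharSpace.map Γ φ (CharSpace.mk f) = CharSpace.mk (φ.comp f) :=
  rfl

variable [TopologicalSpace H]

theorem isEmbedding_coe_hom : IsEmbedding (fun f : Γ →* H => (f : Γ → H)) :=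
  ⟨⟨rfl⟩, DFunLike.coe_injective⟩

theorem continuous_hom_apply (γ : Γ) : Continuous fun f : Γ →* H => f γ :=
  (continuous_apply γ).comp isEmbedding_coe_hom.continuous

instance t2Space_hom [T2Space H] : T2Space (Γ →* H) :=
  isEmbedding_coe_hom.t2Space

instance compactSpace_hom [T2Space H] [CompactSpace H] [ContinuousMul H] :
    CompactSpace (Γ →* H) := by
  have h : IsClosedEmbedding (fun f : Γ →* H => (f : Γ → H)) :=
    ⟨isEmbedding_coe_hom, MonoidHom.isClosed_range_coe Γ H⟩
  exact h.compactSpace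

theorem continuous_comp_hom [TopologicalSpace K] {φ : H →* K} (hφ : Continuous φ) :
    Continuous fun f : Γ →* H => φ.comp f :=
  isEmbedding_coe_hom.continuous_iff.2 <|
    continuous_pi fun γ => hφ.comp (continuous_hom_apply γ)

theorem CharSpace.isQuotientMap_mk : IsQuotientMap (CharSpace.mk : (Γ →* H) → CharSpace Γ H) :=
  isQuotientMap_quotient_mk'

instance CharSpace.compactSpace [CompactSpace (Γ →* H)] : CompactSpace (CharSpace Γ H) :=
  Quotient.compactSpace

/-- If representations lift along a continuous homomorphism of the target groups, the source
representation space being compact, the induced map of character spaces is a quotient map. -/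
theorem CharSpace.isQuotientMap_map [CompactSpace (Γ →* H)] [TopologicalSpace K] [T2Space K] {φ : H →* K}
    (hφ : Continuous φ) (hs : Function.Surjective fun f : Γ →* H => φ.comp f) :
    IsQuotientMap (CharSpace.map Γ φ) := by
  have hc : Continuous fun f : Γ →* H => φ.comp f := continuous_comp_hom hφ
  have h : IsQuotientMap (CharSpace.map Γ φ ∘ CharSpace.mk) :=
    -- A continuous map from a compact space to a Hausdorff space is closed.
    isQuotientMap_mk.comp (hc.isClosedMap.isQuotientMap hc hs)
  exact .of_comp isQuotientMap_mk.continuous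
    (isQuotientMap_mk.continuous_iff.2 h.continuous) h

end Hom

/-! ### Representations of the pair-of-pants group as pairs -/

section Pants

variable {H : Type*} [Group H]

theorem pantsGen_relation (f : PantsGroup →* H) :
    f (pantsGen 2) * f (pantsGen 1) * f (pantsGen 0) = 1 := by
  rw [← map_mul, ← map_mul]
  have : pantsGen 2 * pantsGen 1 * pantsGen 0 = 1 :=
    PresentedGroup.one_of_mem (Set.mem_singleton _)
  rw [this, map_one]

theorem pantsGen_two_eq (f : PantsGroup →* H) :
    f (pantsGen 2) = (f (pantsGen 1) * f (pantsGen 0))⁻¹ :=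
  eq_inv_of_mul_eq_one_left ((mul_assoc _ _ _).symm.trans (pantsGen_relation f))

theorem pantsHom_ext {f f' : PantsGroup →* H} (h0 : f (pantsGen 0) = f' (pantsGen 0))
    (h1 : f (pantsGen 1) = f' (pantsGen 1)) : f = f' := by
  refine PresentedGroup.ext fun i => ?_
  change f (pantsGen i) = f' (pantsGen i)
  fin_cases i
  · exact h0
  · exact h1
  · change f (pantsGen 2) = f' (pantsGen 2)
    rw [pantsGen_two_eq, pantsGen_two_eq, h0, h1]

theorem exists_pantsHom (g h : H) :
    ∃ f : PantsGroup →* H, f (pantsGen 0) = g ∧ f (pantsGen 1) = h := by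
  refine ⟨PresentedGroup.toGroup (f := ![g, h, (h * g)⁻¹]) ?_, ?_, ?_⟩
  · rintro _ rfl
    simp
  · exact PresentedGroup.toGroup.of _
  · exact PresentedGroup.toGroup.of _

theorem mk_eq_mk_of_pantsGen {f f' : PantsGroup →* H} (g : H)
    (h0 : f' (pantsGen 0) = g * f (pantsGen 0) * g⁻¹)
    (h1 : f' (pantsGen 1) = g * f (pantsGen 1) * g⁻¹) : CharSpace.mk f = CharSpace.mk f' := by
  have : f' = (MulAut.conj g).toMonoidHom.comp f := pantsHom_ext h0 h1
  exact CharSpace.mk_eq_mk.2 ⟨g, fun γ => DFunLike.congr_fun this γ⟩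

theorem comp_coveringHom_surjective :
    Function.Surjective fun f : PantsGroup →* SU2 => coveringHom.comp f := by
  intro f
  obtain ⟨g, hg⟩ := coveringHom_surjective (f (pantsGen 0))
  obtain ⟨h, hh⟩ := coveringHom_surjective (f (pantsGen 1))
  obtain ⟨f', h0, h1⟩ := exists_pantsHom g h
  exact ⟨f', pantsHom_ext (by simp [h0, hg]) (by simp [h1, hh])⟩

end Pants

/-! ### The angles of a representation -/

theorem le_of_cos_le_cos_of_nonneg {x y : ℝ} (hx : 0 ≤ x) (hy : y ≤ Real.pi)
    (h : Real.cos x ≤ Real.cos y) : y ≤ x := by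
  by_contra! hlt
  exact absurd h (Real.cos_lt_cos_of_nonneg_of_le_pi hx hy hlt).not_ge

theorem su2Re_mem_Icc (g : SU2) : su2Re g ∈ Set.Icc (-1) 1 := by
  obtain ⟨a, b, c, d, h, rfl⟩ := exists_quatSU g
  rw [su2Re_quatSU]
  constructor <;> nlinarith [sq_nonneg b, sq_nonneg c, sq_nonneg d]

theorem cos_arccos_su2Re (g : SU2) : Real.cos (Real.arccos (su2Re g)) = su2Re g :=
  Real.cos_arccos (su2Re_mem_Icc g).1 (su2Re_mem_Icc g).2

/-- Cauchy–Schwarz: if g and h have vector parts u and v, the difference is −u·v, and the two sines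
are |u| and |v|. -/
theorem abs_su2Re_mul_sub_le (g h : SU2) : |su2Re (h * g) - su2Re g * su2Re h| ≤
    Real.sin (Real.arccos (su2Re g)) * Real.sin (Real.arccos (su2Re h)) := by
  obtain ⟨a, b, c, d, hg, rfl⟩ := exists_quatSU g
  obtain ⟨a', b', c', d', hh, rfl⟩ := exists_quatSU h
  rw [su2Re_mul_quatSU, su2Re_quatSU, su2Re_quatSU, Real.sin_arccos, Real.sin_arccos,
    ← Real.sqrt_mul (by nlinarith [sq_nonneg b, sq_nonneg c, sq_nonneg d])]
  refine Real.abs_le_sqrt ?_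
  have e : 1 - a ^ 2 = b ^ 2 + c ^ 2 + d ^ 2 := by linarith
  have e' : 1 - a' ^ 2 = b' ^ 2 + c' ^ 2 + d' ^ 2 := by linarith
  rw [e, e']
  nlinarith [sq_nonneg (b * c' - c * b'), sq_nonneg (b * d' - d * b'), sq_nonneg (c * d' - d * c')]

/-- The previous bound reads cos(α + β) ≤ cos γ ≤ cos(α − β). Monotonicity of the cosine on [0, π]
turns it into inequalities of angles, one for each face of the tetrahedron. -/
theorem arccos_su2Re_mul_le (g h : SU2) :
    Real.arccos (su2Re (h * g)) ≤ Real.arccos (su2Re g) + Real.arccos (su2Re h) ∧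
    Real.arccos (su2Re (h * g)) ≤
      2 * Real.pi - (Real.arccos (su2Re g) + Real.arccos (su2Re h)) ∧
    Real.arccos (su2Re g) - Real.arccos (su2Re h) ≤ Real.arccos (su2Re (h * g)) ∧
    Real.arccos (su2Re h) - Real.arccos (su2Re g) ≤ Real.arccos (su2Re (h * g)) := by
  have key := abs_le.1 (abs_su2Re_mul_sub_le g h)
  have ha := Real.arccos_nonneg (su2Re g)
  have ha' := Real.arccos_le_pi (su2Re g)
  have hb := Real.arccos_nonneg (su2Re h)
  have hb' := Real.arccos_le_pi (su2Re h)
  have hc := Real.arccos_nonneg (su2Re (h * g))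
  have hc' := Real.arccos_le_pi (su2Re (h * g))
  have h1 := cos_arccos_su2Re g
  have h2 := cos_arccos_su2Re h
  have h3 := cos_arccos_su2Re (h * g)
  generalize Real.arccos (su2Re g) = α at *
  generalize Real.arccos (su2Re h) = β at *
  generalize Real.arccos (su2Re (h * g)) = γ at *
  rw [← h1, ← h2, ← h3] at key
  refine ⟨le_of_cos_le_cos_of_nonneg (by linarith) hc' ?_,
    le_of_cos_le_cos_of_nonneg (by linarith) hc' ?_,
    le_of_cos_le_cos_of_nonneg hc (by linarith) ?_,
    le_of_cos_le_cos_of_nonneg hc (by linarith) ?_⟩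
  · rw [Real.cos_add]
    linarith
  · rw [Real.cos_two_pi_sub, Real.cos_add]
    linarith
  · rw [Real.cos_sub]
    linarith
  · rw [Real.cos_sub]
    linarith

/-- The three angles of a representation of the pair-of-pants group in `SU(2)`. -/
noncomputable def pantsAngle (f : PantsGroup →* SU2) : tetrahedron :=
  ⟨WithLp.toLp 2 ![Real.arccos (su2Re (f (pantsGen 0))), Real.arccos (su2Re (f (pantsGen 1))),
    Real.pi - Real.arccos (su2Re (f (pantsGen 2)))], by
    obtain ⟨h1, h2, h3, h4⟩ := arccos_su2Re_mul_le (f (pantsGen 0)) (f (pantsGen 1))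
    -- C = (BA)⁻¹ has the same real part as BA. The third coordinate is subtracted from π because of
    -- the minus sign in h(C) = −R.
    rw [← su2Re_inv (f (pantsGen 1) * f (pantsGen 0)), ← pantsGen_two_eq] at h1 h2 h3 h4
    refine ⟨?_, ?_, ?_, ?_⟩ <;> simp <;> linarith⟩

theorem pantsAngle_zero (f : PantsGroup →* SU2) :
    (pantsAngle f).1 0 = Real.arccos (su2Re (f (pantsGen 0))) := rfl

theorem pantsAngle_one (f : PantsGroup →* SU2) :
    (pantsAngle f).1 1 = Real.arccos (su2Re (f (pantsGen 1))) := rfl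

theorem pantsAngle_two (f : PantsGroup →* SU2) :
    (pantsAngle f).1 2 = Real.pi - Real.arccos (su2Re (f (pantsGen 2))) := rfl

theorem continuous_pantsAngle : Continuous pantsAngle := by
  refine Continuous.subtype_mk ((PiLp.continuous_toLp 2 _).comp (continuous_pi fun i => ?_)) _
  have h (j : Fin 3) : Continuous fun f : PantsGroup →* SU2 =>
      Real.arccos (su2Re (f (pantsGen j))) :=
    Real.continuous_arccos.comp (continuous_su2Re.comp (continuous_hom_apply _))
  fin_cases i
  · exact h 0
  · exact h 1
  · exact continuous_const.sub (h 2)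

theorem su2Re_eq_of_arccos_eq {g h : SU2}
    (e : Real.arccos (su2Re g) = Real.arccos (su2Re h)) : su2Re g = su2Re h :=
  Real.arccos_injOn (su2Re_mem_Icc g) (su2Re_mem_Icc h) e

/-- The angles carry the same information as the real parts of A, B and BA, which classify pairs up
to conjugation. -/
theorem pantsAngle_eq_iff {f f' : PantsGroup →* SU2} :
    pantsAngle f = pantsAngle f' ↔ CharSpace.mk f = CharSpace.mk f' := by
  constructor
  · intro h
    have h (i : Fin 3) : (pantsAngle f).1 i = (pantsAngle f').1 i := by rw [h]
    have h0 := h 0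
    have h1 := h 1
    have h2 := h 2
    rw [pantsAngle_zero, pantsAngle_zero] at h0
    rw [pantsAngle_one, pantsAngle_one] at h1
    rw [pantsAngle_two, pantsAngle_two] at h2
    have h2 := su2Re_eq_of_arccos_eq (sub_right_injective h2)
    rw [pantsGen_two_eq, pantsGen_two_eq, su2Re_inv, su2Re_inv] at h2
    obtain ⟨k, e0, e1⟩ :=
      exists_conj_of_su2Re_eq (su2Re_eq_of_arccos_eq h0) (su2Re_eq_of_arccos_eq h1) h2
    exact mk_eq_mk_of_pantsGen k e0 e1
  · intro h
    obtain ⟨g, hg⟩ := CharSpace.mk_eq_mk.1 h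
    simp only [pantsAngle, hg, su2Re_conj]

theorem tetrahedron_mem_Icc (x : tetrahedron) (i : Fin 3) : x.1 i ∈ Set.Icc 0 Real.pi := by
  obtain ⟨x, h0, h1, h2, h3⟩ := x
  fin_cases i <;> constructor <;> simp <;> linarith

/-- Provides the cosine of the angle between two axes, including the degenerate case s = 0, where
the axes are irrelevant. -/
theorem exists_mul_eq_of_abs_le {s t : ℝ} (h : |t| ≤ s) : ∃ x : ℝ, x ^ 2 ≤ 1 ∧ s * x = t := by
  rcases eq_or_ne s 0 with rfl | hs
  · exact ⟨0, by norm_num, by rw [abs_nonpos_iff.1 h, mul_zero]⟩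
  · have hpos : 0 < s := lt_of_le_of_ne ((abs_nonneg t).trans h) hs.symm
    refine ⟨t / s, ?_, by field_simp⟩
    rw [sq_le_one_iff_abs_le_one, abs_div, abs_of_pos hpos]
    exact (div_le_one hpos).2 h

theorem pantsAngle_surjective : Function.Surjective pantsAngle := by
  intro x
  obtain ⟨ha, ha'⟩ := tetrahedron_mem_Icc x 0
  obtain ⟨hb, hb'⟩ := tetrahedron_mem_Icc x 1
  obtain ⟨hc, hc'⟩ := tetrahedron_mem_Icc x 2
  obtain ⟨h0, h1, h2, h3⟩ := x.2
  suffices H : ∃ f : PantsGroup →* SU2, su2Re (f (pantsGen 0)) = Real.cos (x.1 0) ∧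
      su2Re (f (pantsGen 1)) = Real.cos (x.1 1) ∧
      su2Re (f (pantsGen 2)) = Real.cos (Real.pi - x.1 2) by
    obtain ⟨f, e0, e1, e2⟩ := H
    refine ⟨f, tetrahedron_ext fun j => ?_⟩
    fin_cases j
    · exact (pantsAngle_zero f).trans (by rw [e0, Real.arccos_cos ha ha']; rfl)
    · exact (pantsAngle_one f).trans (by rw [e1, Real.arccos_cos hb hb']; rfl)
    · exact (pantsAngle_two f).trans
        (by rw [e2, Real.arccos_cos (by linarith) (by linarith)]; exact sub_sub_cancel _ _)
  generalize x.1 0 = α at *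
  generalize x.1 1 = β at *
  obtain ⟨γ, hγ⟩ : ∃ γ, γ = Real.pi - x.1 2 := ⟨_, rfl⟩
  rw [← hγ]
  -- Both γ ≤ α + β and γ ≤ 2π − (α + β) are face inequalities; the one whose right side lies in [0,
  -- π] is used.
  have hlow : Real.cos (α + β) ≤ Real.cos γ := by
    rcases le_total (α + β) Real.pi with h | h
    · exact Real.cos_le_cos_of_nonneg_of_le_pi (by linarith) h (by linarith)
    · rw [← Real.cos_two_pi_sub]
      exact Real.cos_le_cos_of_nonneg_of_le_pi (by linarith) (by linarith) (by linarith)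
  have hupp : Real.cos γ ≤ Real.cos (α - β) := by
    rw [← Real.cos_abs (α - β)]
    exact Real.cos_le_cos_of_nonneg_of_le_pi (abs_nonneg _) (by linarith)
      (abs_le.2 ⟨by linarith, by linarith⟩)
  rw [Real.cos_add] at hlow
  rw [Real.cos_sub] at hupp
  -- A gets axis i and B an axis in the ij-plane at angle arccos t from it; this equation for t
  -- makes Re(BA) equal to cos γ.
  obtain ⟨t, ht, hst⟩ := exists_mul_eq_of_abs_le
    (s := Real.sin α * Real.sin β) (t := Real.cos α * Real.cos β - Real.cos γ)
    (abs_le.2 ⟨by linarith, by linarith⟩)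
  have hu : √(1 - t ^ 2) ^ 2 = 1 - t ^ 2 := Real.sq_sqrt (by linarith)
  obtain ⟨f, e0, e1⟩ := exists_pantsHom
    (quatSU (Real.cos α) (Real.sin α) 0 0 (by linarith [Real.sin_sq_add_cos_sq α]))
    (quatSU (Real.cos β) (Real.sin β * t) (Real.sin β * √(1 - t ^ 2)) 0 (by
      linear_combination Real.sin β ^ 2 * hu + Real.sin_sq_add_cos_sq β))
  refine ⟨f, by rw [e0, su2Re_quatSU], by rw [e1, su2Re_quatSU], ?_⟩
  rw [pantsGen_two_eq, su2Re_inv, e0, e1, su2Re_mul_quatSU]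
  linarith

/-- The angles of an `SU(2)`-character. -/
noncomputable def characterAngle : CharSpace PantsGroup SU2 → tetrahedron :=
  Quotient.lift pantsAngle fun _ _ h => pantsAngle_eq_iff.2 (Quotient.sound h)

/-- The character space is compact, as a quotient of a closed subspace of a power of `SU2`, and the
tetrahedron is Hausdorff. -/
theorem isHomeomorph_characterAngle : IsHomeomorph characterAngle := by
  refine isHomeomorph_iff_continuous_bijective.2
    ⟨continuous_pantsAngle.quotient_lift _, fun a b => ?_, fun x => ?_⟩
  · induction a using Quotient.inductionOn with | _ f
    induction b using Quotient.inductionOn with | _ f'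
    exact pantsAngle_eq_iff.1
  · obtain ⟨f, hf⟩ := pantsAngle_surjective x
    exact ⟨CharSpace.mk f, hf⟩

/-- The homeomorphism from the space of `SU(2)`-characters to the tetrahedron. -/
noncomputable def angleHomeomorph : CharSpace PantsGroup SU2 ≃ₜ tetrahedron :=
  isHomeomorph_characterAngle.homeomorph

theorem angleHomeomorph_symm_pantsAngle (f : PantsGroup →* SU2) :
    angleHomeomorph.symm (pantsAngle f) = CharSpace.mk f :=
  angleHomeomorph.symm_apply_apply (CharSpace.mk f)

instance compactSpace_tetrahedron : CompactSpace tetrahedron :=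
  angleHomeomorph.compactSpace

/-! ### Rotations -/

theorem rotSU_eq_quatMat (w : EuclideanSpace ℝ (Fin 3)) (θ : ℝ) :
    rotSU w (2 * θ) = quatMat (Real.cos θ) (Real.sin θ * w 0) (Real.sin θ * w 1)
      (Real.sin θ * w 2) := by
  have h : 2 * θ / 2 = θ := by ring
  rw [rotSU, h]
  ext i j
  fin_cases i <;> fin_cases j <;>
    simp [quatMat, pureQuat, quatUnit, Fin.sum_univ_three, Complex.ext_iff,
      -Complex.ofReal_cos, -Complex.ofReal_sin]

theorem exists_rotSU_of_su2Re_eq_cos {g : SU2} {θ : ℝ} (h : su2Re g = Real.cos θ) :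
    ∃ w : EuclideanSpace ℝ (Fin 3), ‖w‖ = 1 ∧ g.1 = rotSU w (2 * θ) := by
  obtain ⟨a, b, c, d, hn, rfl⟩ := exists_quatSU g
  rw [su2Re_quatSU] at h
  subst h
  have hs := Real.sin_sq_add_cos_sq θ
  simp only [rotSU_eq_quatMat, quatSU]
  rcases eq_or_ne (Real.sin θ) 0 with h0 | h0
  · rw [h0] at hs ⊢
    have hb : b = 0 := by nlinarith [sq_nonneg b, sq_nonneg c, sq_nonneg d]
    have hc : c = 0 := by nlinarith [sq_nonneg b, sq_nonneg c, sq_nonneg d]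
    have hd : d = 0 := by nlinarith [sq_nonneg b, sq_nonneg c, sq_nonneg d]
    -- Here g = ±1, and any unit vector can serve as axis.
    exact ⟨EuclideanSpace.single 0 1, by simp, by simp [hb, hc, hd]⟩
  · refine ⟨WithLp.toLp 2 ![b / Real.sin θ, c / Real.sin θ, d / Real.sin θ], ?_, ?_⟩
    · rw [EuclideanSpace.norm_eq, Real.sqrt_eq_one]
      simp only [Fin.sum_univ_three, Real.norm_eq_abs, sq_abs]
      simp
      field_simp
      linarith
    · congr 1 <;> simp <;> field_simp

theorem exists_eq_neg_rotSU_of_su2Re_eq_cos {g : SU2} {θ : ℝ}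
    (h : su2Re g = Real.cos (Real.pi - θ)) :
    ∃ w : EuclideanSpace ℝ (Fin 3), ‖w‖ = 1 ∧ g.1 = -rotSU w (2 * θ) := by
  rw [Real.cos_pi_sub] at h
  obtain ⟨w, hw, e⟩ := exists_rotSU_of_su2Re_eq_cos (g := negOneSU * g) (θ := θ)
    (by rw [su2Re_negOneSU_mul, h, neg_neg])
  refine ⟨w, hw, ?_⟩
  rw [← e]
  obtain ⟨a, b, c, d, hn, rfl⟩ := exists_quatSU g
  rw [negOneSU_mul_quatSU]
  simp [quatSU, quatMat_neg]

theorem exists_rotSU_pantsAngle (f : PantsGroup →* SU2) :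
    ∃ w : Fin 3 → EuclideanSpace ℝ (Fin 3), (∀ i, ‖w i‖ = 1) ∧
      (f (pantsGen 0)).1 = rotSU (w 0) (2 * (pantsAngle f).1 0) ∧
      (f (pantsGen 1)).1 = rotSU (w 1) (2 * (pantsAngle f).1 1) ∧
      (f (pantsGen 2)).1 = -rotSU (w 2) (2 * (pantsAngle f).1 2) := by
  obtain ⟨u, hu, e0⟩ := exists_rotSU_of_su2Re_eq_cos (cos_arccos_su2Re (f (pantsGen 0))).symm
  obtain ⟨v, hv, e1⟩ := exists_rotSU_of_su2Re_eq_cos (cos_arccos_su2Re (f (pantsGen 1))).symm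
  obtain ⟨w, hw, e2⟩ := exists_eq_neg_rotSU_of_su2Re_eq_cos (g := f (pantsGen 2))
    (θ := Real.pi - Real.arccos (su2Re (f (pantsGen 2))))
    (by rw [sub_sub_cancel, cos_arccos_su2Re])
  refine ⟨![u, v, w], fun i => ?_, e0, e1, e2⟩
  fin_cases i <;> assumption

/-! ### The fibres of the map of character spaces -/

/-- The index i marks the generator that keeps its sign. The relation CBA = 1 forces an even number
of sign changes, so the signs on A and B determine that on C. -/
theorem pantsGen_eq_of_twist {f f' : PantsGroup →* SU2} {i : Fin 3}
    (h0 : f' (pantsGen 0) = if 0 = i then f (pantsGen 0) else negOneSU * f (pantsGen 0))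
    (h1 : f' (pantsGen 1) = if 1 = i then f (pantsGen 1) else negOneSU * f (pantsGen 1))
    (j : Fin 3) :
    f' (pantsGen j) = if j = i then f (pantsGen j) else negOneSU * f (pantsGen j) := by
  have hN : negOneSU⁻¹ = negOneSU := inv_eq_of_mul_eq_one_left negOneSU_mul_self
  have h2 := pantsGen_two_eq f'
  have h2' := pantsGen_two_eq f
  fin_cases j
  · exact h0
  · exact h1
  · change f' (pantsGen 2) = if 2 = i then f (pantsGen 2) else negOneSU * f (pantsGen 2)
    rw [h2, h0, h1, h2']
    fin_cases i <;> simp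
    · rw [hN, ← mul_assoc, negOneSU_mul_comm]
    · rw [hN, negOneSU_mul_comm, mul_assoc]
    · rw [hN, negOneSU_mul_comm (f (pantsGen 1))⁻¹, ← mul_assoc, mul_assoc (f (pantsGen 0))⁻¹,
        negOneSU_mul_self, mul_one]

/-- A sign change negates the real part, and arccos(−x) = π − arccos x. -/
theorem pantsAngle_of_twist {f f' : PantsGroup →* SU2} {i : Fin 3}
    (h : ∀ j, f' (pantsGen j) = if j = i then f (pantsGen j) else negOneSU * f (pantsGen j)) :
    pantsAngle f' = halfTurn i (pantsAngle f) := by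
  refine tetrahedron_ext fun j => ?_
  rw [halfTurn_apply]
  have e : su2Re (f' (pantsGen j)) = if j = i then su2Re (f (pantsGen j)) else
      -su2Re (f (pantsGen j)) := by
    rw [h]
    split_ifs
    · rfl
    · rw [su2Re_negOneSU_mul]
  fin_cases j
  · change Real.arccos (su2Re (f' (pantsGen 0))) = if 0 = i then
      Real.arccos (su2Re (f (pantsGen 0))) else Real.pi - Real.arccos (su2Re (f (pantsGen 0)))
    change su2Re (f' (pantsGen 0)) = if 0 = i then _ else -su2Re (f (pantsGen 0)) at e
    rw [e]
    split_ifs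
    · rfl
    · rw [Real.arccos_neg]
  · change Real.arccos (su2Re (f' (pantsGen 1))) = if 1 = i then
      Real.arccos (su2Re (f (pantsGen 1))) else Real.pi - Real.arccos (su2Re (f (pantsGen 1)))
    change su2Re (f' (pantsGen 1)) = if 1 = i then _ else -su2Re (f (pantsGen 1)) at e
    rw [e]
    split_ifs
    · rfl
    · rw [Real.arccos_neg]
  · change Real.pi - Real.arccos (su2Re (f' (pantsGen 2))) = if 2 = i then
      Real.pi - Real.arccos (su2Re (f (pantsGen 2))) else
      Real.pi - (Real.pi - Real.arccos (su2Re (f (pantsGen 2))))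
    change su2Re (f' (pantsGen 2)) = if 2 = i then _ else -su2Re (f (pantsGen 2)) at e
    rw [e]
    split_ifs
    · rfl
    · rw [Real.arccos_neg]

theorem coveringHom_negOneSU_mul (g : SU2) : coveringHom (negOneSU * g) = coveringHom g := by
  rw [map_mul, coveringHom_negOneSU, one_mul]

/-- The map from the tetrahedron to the space of `SO(3)`-characters. -/
noncomputable def angleToSO3 (x : tetrahedron) : CharSpace PantsGroup SO3 :=
  CharSpace.map PantsGroup coveringHom (angleHomeomorph.symm x)

theorem angleToSO3_pantsAngle (f : PantsGroup →* SU2) :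
    angleToSO3 (pantsAngle f) = CharSpace.mk (coveringHom.comp f) := by
  rw [angleToSO3, angleHomeomorph_symm_pantsAngle, CharSpace.map_mk]

theorem angleToSO3_halfTurn (i : Fin 3) (x : tetrahedron) :
    angleToSO3 (halfTurn i x) = angleToSO3 x := by
  obtain ⟨f, rfl⟩ := pantsAngle_surjective x
  obtain ⟨f', h0, h1⟩ := exists_pantsHom
    (if 0 = i then f (pantsGen 0) else negOneSU * f (pantsGen 0))
    (if 1 = i then f (pantsGen 1) else negOneSU * f (pantsGen 1))
  rw [← pantsAngle_of_twist (pantsGen_eq_of_twist h0 h1), angleToSO3_pantsAngle,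
    angleToSO3_pantsAngle]
  congr 1
  refine pantsHom_ext ?_ ?_
  · rw [MonoidHom.comp_apply, MonoidHom.comp_apply, h0]
    split_ifs
    · rfl
    · rw [coveringHom_negOneSU_mul]
  · rw [MonoidHom.comp_apply, MonoidHom.comp_apply, h1]
    split_ifs
    · rfl
    · rw [coveringHom_negOneSU_mul]

/-- An element conjugating the `SO3` representations lifts to `SU2`. After this conjugation the two
lifts agree up to signs on A and B, and the four possibilities are the four elements of V. -/
theorem angleToSO3_eq_iff {x y : tetrahedron} :
    angleToSO3 x = angleToSO3 y ↔ x ∈ MulAction.orbit kleinV y := by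
  constructor
  · intro h
    obtain ⟨f', rfl⟩ := pantsAngle_surjective x
    obtain ⟨f, rfl⟩ := pantsAngle_surjective y
    rw [angleToSO3_pantsAngle, angleToSO3_pantsAngle] at h
    obtain ⟨R, hR⟩ := CharSpace.mk_eq_mk.1 h.symm
    obtain ⟨k, rfl⟩ := coveringHom_surjective R
    set f₁ : PantsGroup →* SU2 := (MulAut.conj k).toMonoidHom.comp f with hf₁
    have hmk : CharSpace.mk f = CharSpace.mk f₁ := CharSpace.mk_eq_mk.2 ⟨k, fun _ => rfl⟩
    rw [pantsAngle_eq_iff.2 hmk]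
    have hc (γ : PantsGroup) : coveringHom (f' γ) = coveringHom (f₁ γ) := by
      change _ = coveringHom (k * f γ * k⁻¹)
      rw [map_mul, map_mul, map_inv]
      exact hR γ
    have key (i : Fin 3)
        (h0 : f' (pantsGen 0) = if 0 = i then f₁ (pantsGen 0) else negOneSU * f₁ (pantsGen 0))
        (h1 : f' (pantsGen 1) = if 1 = i then f₁ (pantsGen 1) else negOneSU * f₁ (pantsGen 1)) :
        pantsAngle f' ∈ MulAction.orbit kleinV (pantsAngle f₁) :=
      ⟨⟨halfTurn i, Or.inr ⟨i, rfl⟩⟩, (pantsAngle_of_twist (pantsGen_eq_of_twist h0 h1)).symm⟩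
    rcases eq_or_of_coveringHom_eq (hc (pantsGen 0)) with h0 | h0 <;>
      rcases eq_or_of_coveringHom_eq (hc (pantsGen 1)) with h1 | h1
    · rw [pantsHom_ext h0 h1]
      exact MulAction.mem_orbit_self _
    · exact key 0 (by simpa using h0) (by simpa using h1)
    · exact key 1 (by simpa using h0) (by simpa using h1)
    · exact key 2 (by simpa using h0) (by simpa using h1)
  · rintro ⟨⟨_, rfl | ⟨i, rfl⟩⟩, rfl⟩
    · rfl
    · exact angleToSO3_halfTurn i y

theorem isQuotientMap_angleToSO3 : IsQuotientMap angleToSO3 :=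
  (CharSpace.isQuotientMap_map continuous_coveringHom comp_coveringHom_surjective).comp
    angleHomeomorph.symm.isQuotientMap

/-! ### Branched coverings from finite group actions -/

section FiniteGroup

variable {G E X : Type*} [Group G] [Finite G] [TopologicalSpace E] [MulAction G E]
  [ContinuousConstSMul G E] [TopologicalSpace X] {F : E → X}

omit [Finite G] [TopologicalSpace E] [ContinuousConstSMul G E] [TopologicalSpace X] in
theorem preimage_image_eq_iUnion_smul
    (hG : ∀ {x y}, F x = F y ↔ x ∈ MulAction.orbit G y) (U : Set E) :
    F ⁻¹' (F '' U) = ⋃ g : G, (g • ·) ⁻¹' U := by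
  ext x
  simp only [Set.mem_preimage, Set.mem_image, Set.mem_iUnion]
  constructor
  · rintro ⟨y, hy, hxy⟩
    obtain ⟨g, rfl⟩ := hG.1 hxy
    exact ⟨g, hy⟩
  · rintro ⟨g, hg⟩
    exact ⟨g • x, hg, hG.2 ⟨g, rfl⟩⟩

/-- The quotient by a finite group of homeomorphisms that acts freely on a dense set is a branched
covering. -/
theorem isBranchedCovering_of_finite_group [T2Space E] [LocallyCompactSpace E]
    (hF : IsQuotientMap F) (hG : ∀ {x y}, F x = F y ↔ x ∈ MulAction.orbit G y)
    (hd : Dense {x : E | MulAction.stabilizer G x = ⊥}) :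
    IsBranchedCovering (Nat.card G) F {x : E | MulAction.stabilizer G x = ⊥}ᶜ := by
  have hfib (x : E) : F ⁻¹' {F x} = MulAction.orbit G x := by
    ext y
    exact hG
  have hne {x : E} (hx : x ∈ {x : E | MulAction.stabilizer G x = ⊥}ᶜ) :
      ∃ g : G, g ≠ 1 ∧ g • x = x := by
    obtain ⟨g, hg⟩ := Subgroup.ne_bot_iff_exists_ne_one.1 hx
    exact ⟨g, fun h => hg (Subtype.ext h), g.2⟩
  have hne' {x : E} {g : G} (h1 : g ≠ 1) (hg : g • x = x) :
      x ∈ {x : E | MulAction.stabilizer G x = ⊥}ᶜ := fun h =>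
    h1 (((Subgroup.eq_bot_iff_forall _).1 h) g hg)
  have hsat : F ⁻¹' (F '' {x : E | MulAction.stabilizer G x = ⊥}ᶜ) =
      {x : E | MulAction.stabilizer G x = ⊥}ᶜ := by
    -- Stabilizers along an orbit are conjugate, so nontriviality is constant on fibres.
    refine (Set.subset_preimage_image _ _).antisymm' ?_
    rintro x ⟨y, hy, hxy⟩
    obtain ⟨g, rfl⟩ := hG.1 hxy
    obtain ⟨k, hk1, hk⟩ := hne hy
    refine hne' (g := g⁻¹ * k * g) (fun h => hk1 ?_) ?_
    · rwa [mul_assoc, inv_mul_eq_one, eq_comm, mul_eq_right] at h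
    · have h : k • g • x = g • x := hk
      rw [mul_smul, mul_smul, h, inv_smul_smul]
  refine ⟨hF.continuous, hF.surjective, fun U hU => ?_, fun U hU => ?_, fun y => ?_, ?_, ?_, hsat,
    ?_, fun y hy => ?_, fun x hx U hU hinj => ?_⟩
  · rw [← hF.isOpen_preimage, preimage_image_eq_iUnion_smul hG]
    exact isOpen_iUnion fun g => hU.preimage (continuous_const_smul g)
  · rw [← hF.isClosed_preimage, preimage_image_eq_iUnion_smul hG]
    exact isClosed_iUnion_of_finite fun g => hU.preimage (continuous_const_smul g)
  · obtain ⟨x, rfl⟩ := hF.surjective y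
    rw [hfib]
    exact Set.finite_range _
  -- The branch set is a finite union of fixed-point sets, each closed because E is Hausdorff.
  · have : {x : E | MulAction.stabilizer G x = ⊥}ᶜ =
        ⋃ g : {g : G // g ≠ 1}, {x : E | g.1 • x = x} := by
      ext x
      simp only [Set.mem_iUnion, Set.mem_ofPred_eq, Subtype.exists, exists_prop]
      exact ⟨hne, fun ⟨g, h1, hg⟩ => hne' h1 hg⟩
    rw [this]
    exact isClosed_iUnion_of_finite fun g => isClosed_eq (continuous_const_smul g.1) continuous_id
  · rwa [compl_compl]
  · refine (hF.isCoveringMapOn_of_properlyDiscontinuousSMul hG).mono fun y hy => ?_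
    obtain ⟨x, rfl⟩ := hF.surjective y
    exact ⟨x, not_not.1 fun h => hy ⟨x, h, rfl⟩, rfl⟩
  · obtain ⟨x, rfl⟩ := hF.surjective y
    have hx : MulAction.stabilizer G x = ⊥ := not_not.1 fun h => hy ⟨x, h, rfl⟩
    rw [hfib, MulAction.orbit, Set.ncard_range_of_injective]
    intro g h hgh
    have hgh : g • x = h • x := hgh
    have : h⁻¹ * g ∈ MulAction.stabilizer G x := by
      rw [MulAction.mem_stabilizer_iff, mul_smul, hgh, inv_smul_smul]
    rw [hx, Subgroup.mem_bot, inv_mul_eq_one] at this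
    exact this.symm
  -- Let g ≠ 1 fix x. Some y near x has trivial stabilizer and both y and gy in U; they have the
  -- same image but are distinct.
  · obtain ⟨g, hg1, hg⟩ := hne hx
    have hgU : (g • ·) ⁻¹' U ∈ 𝓝 x :=
      (continuous_const_smul g).continuousAt.preimage_mem_nhds (by rwa [hg])
    obtain ⟨y, hy, hyU, hyg⟩ := hd.inter_nhds_nonempty (Filter.inter_mem hU hgU)
    have hgy : g • y = y := hinj hyg hyU (hG.2 ⟨g, rfl⟩)
    exact hne' hg1 hgy hy

end FiniteGroup

theorem IsBranchedCovering.comp_homeomorph {X Y Z : Type*} [TopologicalSpace X]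
    [TopologicalSpace Y] [TopologicalSpace Z] {n : ℕ} {f : Y → Z} {B : Set Y}
    (h : IsBranchedCovering n f B) (e : X ≃ₜ Y) : IsBranchedCovering n (f ∘ e) (e ⁻¹' B) := by
  have himg : (f ∘ e) '' (e ⁻¹' B) = f '' B := by
    rw [Set.image_comp, Set.image_preimage_eq _ e.surjective]
  refine ⟨h.continuous.comp e.continuous, h.surjective.comp e.surjective,
    h.isOpenMap.comp e.isOpenMap, h.isClosedMap.comp e.isClosedMap, fun y => ?_,
    h.isClosed_branch.preimage e.continuous, ?_, ?_, ?_, fun y hy => ?_,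
    fun x hx U hU hinj => ?_⟩
  · rw [Set.preimage_comp]
    exact (h.finite_fibre y).preimage e.injective.injOn
  · exact h.dense_compl_branch.preimage e.isOpenMap
  · rw [himg, Set.preimage_comp, h.saturated_branch]
  · rw [himg]
    exact h.isCoveringMapOn.comp_homeomorph e
  · rw [himg] at hy
    rw [← h.card_fibre y hy, Set.preimage_comp]
    exact Set.ncard_preimage_of_injective_subset_range e.injective (by simp [e.surjective.range_eq])
  · refine h.not_locally_injective (e x) hx (e '' U) (e.isOpenMap.image_mem_nhds hU) ?_
    rintro _ ⟨a, ha, rfl⟩ _ ⟨b, hb, rfl⟩ hab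
    rw [hinj ha hb hab]

/-! ### The Klein four-group -/

theorem mem_axis_iff {i : Fin 3} {x : tetrahedron} :
    x ∈ axis i ↔ ∀ j, j ≠ i → x.1 j = Real.pi / 2 := by
  constructor
  · intro h j hj
    have h : halfTurn i x = x := h
    have := halfTurn_apply i x j
    rw [h, if_neg hj] at this
    linarith
  · intro h
    refine tetrahedron_ext fun j => ?_
    rw [halfTurn_apply]
    split_ifs with hj
    · rfl
    · rw [h j hj]
      ring

/-- The vertex `(π, π, π)` of the tetrahedron. -/
noncomputable def topVertex : tetrahedron :=
  ⟨WithLp.toLp 2 fun _ => Real.pi, by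
    have := Real.pi_pos
    refine ⟨?_, ?_, ?_, ?_⟩ <;> simp; linarith⟩

/-- The half-turns send the top vertex to the three other vertices, which tells the elements of V
apart. -/
theorem halfTurn_topVertex (i j : Fin 3) :
    (halfTurn i topVertex).1 j = if j = i then Real.pi else 0 := by
  rw [halfTurn_apply]
  change (if j = i then Real.pi else Real.pi - Real.pi) = _
  rw [sub_self]

theorem halfTurn_ne_one (i : Fin 3) : halfTurn i ≠ 1 := by
  intro h
  have hj : i + 1 ≠ i := by fin_cases i <;> decide
  have e := halfTurn_topVertex i (i + 1)
  rw [h, if_neg hj] at e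
  exact Real.pi_ne_zero e

theorem halfTurn_injective : Function.Injective halfTurn := by
  intro i k h
  by_contra hik
  have e := halfTurn_topVertex i i
  rw [h, halfTurn_topVertex, if_neg hik, if_pos rfl] at e
  exact Real.pi_ne_zero e.symm

theorem card_kleinV : Nat.card kleinV = 4 := by
  let φ : Option (Fin 3) → kleinV := fun o =>
    o.elim 1 fun i => ⟨halfTurn i, Or.inr ⟨i, rfl⟩⟩
  have hφ : Function.Bijective φ := by
    constructor
    · rintro (_ | i) (_ | j) h
      · rfl
      · exact absurd (congrArg Subtype.val h).symm (halfTurn_ne_one j)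
      · exact absurd (congrArg Subtype.val h) (halfTurn_ne_one i)
      · rw [halfTurn_injective (congrArg Subtype.val h)]
    · rintro ⟨_, rfl | ⟨i, rfl⟩⟩
      · exact ⟨none, rfl⟩
      · exact ⟨some i, rfl⟩
  rw [← Nat.card_congr (Equiv.ofBijective φ hφ)]
  simp

instance finite_kleinV : Finite kleinV :=
  Nat.finite_of_card_ne_zero (by rw [card_kleinV]; norm_num)

theorem isKleinFour_kleinV : IsKleinFour kleinV where
  card_four := card_kleinV
  exponent_two := by
    have : Nontrivial kleinV :=
      Finite.one_lt_card_iff_nontrivial.1 (by rw [card_kleinV]; norm_num)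
    refine (Monoid.exponent_eq_prime_iff Nat.prime_two).2 fun g hg => ?_
    refine orderOf_eq_prime ?_ hg
    obtain ⟨_, rfl | ⟨i, rfl⟩⟩ := g
    · exact one_pow _
    · exact Subtype.ext ((sq _).trans (halfTurn_mul_self i))

instance continuousConstSMul_kleinV : ContinuousConstSMul kleinV tetrahedron :=
  ⟨fun v => v.1.continuous⟩

theorem stabilizer_kleinV_eq_bot_iff {x : tetrahedron} :
    MulAction.stabilizer kleinV x = ⊥ ↔ ∀ i, x ∉ axis i := by
  rw [Subgroup.eq_bot_iff_forall]
  constructor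
  · intro h i hi
    exact halfTurn_ne_one i (congrArg Subtype.val (h ⟨halfTurn i, Or.inr ⟨i, rfl⟩⟩ hi))
  · rintro h ⟨_, rfl | ⟨i, rfl⟩⟩ hx
    · rfl
    · exact absurd hx (h i)

theorem iUnion_axis_eq :
    ⋃ i, axis i = {x : tetrahedron | MulAction.stabilizer kleinV x = ⊥}ᶜ := by
  ext x
  simp [stabilizer_kleinV_eq_bot_iff]

/-! ### Density of the complement of the axes -/

theorem convex_tetrahedron : Convex ℝ tetrahedron := by
  rintro x ⟨h0, h1, h2, h3⟩ y ⟨k0, k1, k2, k3⟩ a b ha hb hab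
  obtain rfl : a = 1 - b := by linarith
  refine ⟨?_, ?_, ?_, ?_⟩ <;> simp <;> nlinarith

/-- The point of the tetrahedron that divides the segment from `x` to `(π, π, π)` in the ratio
`s : 1 - s`. -/
noncomputable def toTopVertex (x : tetrahedron) (s : unitInterval) : tetrahedron :=
  ⟨(1 - s.1) • x.1 + s.1 • topVertex.1, convex_tetrahedron x.2 topVertex.2
    (sub_nonneg.2 s.2.2) s.2.1 (sub_add_cancel _ _)⟩

theorem continuous_toTopVertex (x : tetrahedron) : Continuous (toTopVertex x) := by
  refine Continuous.subtype_mk ?_ _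
  fun_prop

/-- Some coordinate j differs from both i and k. It equals π/2 on both axes, but moves strictly away
from π/2 on the way to the top vertex. -/
theorem toTopVertex_notMem_axis {x : tetrahedron} {i : Fin 3} (hx : x ∈ axis i)
    {s : unitInterval} (hs : s ≠ 0) (k : Fin 3) : toTopVertex x s ∉ axis k := by
  intro h
  have third : ∀ i k : Fin 3, ∃ j, j ≠ i ∧ j ≠ k := by decide
  obtain ⟨j, hji, hjk⟩ := third i k
  have e1 := mem_axis_iff.1 hx j hji
  have e2 := mem_axis_iff.1 h j hjk
  have e3 : (toTopVertex x s).1 j = (1 - s.1) * x.1 j + s.1 * Real.pi := rfl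
  rw [e3, e1] at e2
  have : s.1 * Real.pi = 0 := by linarith
  exact hs (Subtype.ext ((mul_eq_zero.1 this).resolve_right Real.pi_ne_zero))

theorem dense_stabilizer_eq_bot :
    Dense {x : tetrahedron | MulAction.stabilizer kleinV x = ⊥} := by
  intro x
  by_cases h : ∀ i, x ∉ axis i
  · exact subset_closure (stabilizer_kleinV_eq_bot_iff.2 h)
  · push Not at h
    obtain ⟨i, hi⟩ := h
    have h0 : toTopVertex x 0 = x := tetrahedron_ext fun j => by
      change (1 - 0) * x.1 j + 0 * Real.pi = x.1 j
      ring
    have ht : Filter.Tendsto (toTopVertex x) (𝓝[≠] 0) (𝓝 x) := by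
      have := (continuous_toTopVertex x).continuousAt (x := 0)
      rw [ContinuousAt, h0] at this
      exact this.mono_left nhdsWithin_le_nhds
    refine mem_closure_of_tendsto ht (eventually_mem_nhdsWithin.mono fun s hs => ?_)
    exact stabilizer_kleinV_eq_bot_iff.2 (toTopVertex_notMem_axis hi hs)

theorem isBranchedCovering_angleToSO3 : IsBranchedCovering 4 angleToSO3 (⋃ i, axis i) := by
  rw [iUnion_axis_eq, ← card_kleinV]
  exact isBranchedCovering_of_finite_group isQuotientMap_angleToSO3 angleToSO3_eq_iff
    dense_stabilizer_eq_bot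

/-- The homeomorphism from the quotient of the tetrahedron by the Klein four-group to the space of
`SO(3)`-characters. -/
theorem exists_orbit_homeomorph :
    ∃ q : MulAction.orbitRel.Quotient kleinV tetrahedron ≃ₜ CharSpace PantsGroup SO3,
      ∀ x : tetrahedron,
        q (Quotient.mk (MulAction.orbitRel kleinV tetrahedron) x) = angleToSO3 x := by
  let q : MulAction.orbitRel.Quotient kleinV tetrahedron → CharSpace PantsGroup SO3 :=
    Quotient.lift angleToSO3 fun _ _ h => angleToSO3_eq_iff.2 h
  have hq : IsHomeomorph q := by
    refine isHomeomorph_iff_isQuotientMap_injective.2 ⟨?_, fun a b => ?_⟩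
    · exact .of_comp continuous_quot_mk
        (isQuotientMap_angleToSO3.continuous.quotient_lift _) isQuotientMap_angleToSO3
    · induction a using Quotient.inductionOn with | _ x
      induction b using Quotient.inductionOn with | _ y
      exact fun h => Quotient.sound (angleToSO3_eq_iff.1 h)
  exact ⟨hq.homeomorph, fun _ => rfl⟩

/-- The space of `SU(2)`-characters of the pair-of-pants group is homeomorphic to the tetrahedron
(through the angles of the rotations), and its map to the space of `SO(3)`-characters is a
four-to-one branched covering, induced by the action of the Klein four-group `V`. -/
theorem mainTheorem10 :
    IsKleinFour kleinV ∧
    ∃ e : CharSpace PantsGroup SU2 ≃ₜ tetrahedron,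
      (∀ h : PantsGroup →* SU2, ∃ w : Fin 3 → EuclideanSpace ℝ (Fin 3), (∀ i, ‖w i‖ = 1) ∧
        (h (pantsGen 0) : Matrix (Fin 2) (Fin 2) ℂ)
          = rotSU (w 0) (2 * (e (CharSpace.mk h) : EuclideanSpace ℝ (Fin 3)) 0) ∧
        (h (pantsGen 1) : Matrix (Fin 2) (Fin 2) ℂ)
          = rotSU (w 1) (2 * (e (CharSpace.mk h) : EuclideanSpace ℝ (Fin 3)) 1) ∧
        (h (pantsGen 2) : Matrix (Fin 2) (Fin 2) ℂ)
          = -rotSU (w 2) (2 * (e (CharSpace.mk h) : EuclideanSpace ℝ (Fin 3)) 2)) ∧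
      (∃ q : MulAction.orbitRel.Quotient kleinV tetrahedron ≃ₜ CharSpace PantsGroup SO3,
        ∀ x : tetrahedron,
          q (Quotient.mk (MulAction.orbitRel kleinV tetrahedron) x)
            = CharSpace.map PantsGroup coveringHom (e.symm x)) ∧
      IsBranchedCovering 4 (CharSpace.map PantsGroup coveringHom) (e ⁻¹' (⋃ i, axis i)) := by
  refine ⟨isKleinFour_kleinV, angleHomeomorph, fun f => exists_rotSU_pantsAngle f,
    exists_orbit_homeomorph, ?_⟩
  -- `angleToSO3` is p ∘ e⁻¹, so composing it with e gives back p.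
  convert isBranchedCovering_angleToSO3.comp_homeomorph angleHomeomorph using 1
  ext x
  exact congrArg _ (angleHomeomorph.symm_apply_apply x).symm
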